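/- **Setting.** An episodic MDP with finite state space $\mathcal S$ ($|\mathcal S|=S$), finite action space $\mathcal A$ ($|\mathcal A|=A$) and horizon $H$ consists of transition kernels $P_h(\cdot\mid s,a)$ and deterministic rewards $r_h(s,a)\in[0,1]$, $h=1,\dots,H$. A (deterministic Markov) policy is $\pi=(\pi_h)_{h=1}^H$ with $\pi_h:\mathcal S\to\mathcal A$. For $\beta>0$ let $U_\beta(X)=\frac1\beta\log\mathbb E[e^{\beta X}]$ be the entropic risk measure, let $V^\pi_1(s)=U_\beta\big(\sum_{h=1}^H r_h(s_h,a_h)\big)$ for the trajectory with $s_1=s$, $a_h=\pi_h(s_h)$, $s_{h+1}\sim P_h(\cdot\mid s_h,a_h)$, and let $V^*_1(s)=\max_\pi V^\pi_1(s)$. An algorithm for $K$ episodes is a sequence $\mathscr A=(\mathscr A_k)_{k=1}^K$ of functions, where $\mathscr A_k$ maps the trajectories $(s_1,a_1,\dots,s_H,a_H)$ of the first $k-1$ episodes, together with the (known) reward functions $(r_h)_h$, to the policy $\pi^k$ that is followed in episode $k$. Its regret is $\mathrm{Regret}(\mathscr A,\mathcal M,K)=\sum_{k=1}^K\big(V^*_1(s^k_1)-V^{\pi^k}_1(s^k_1)\big)$,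 where $s_1^k$ is the initial state of episode $k$; the expected regret is its expectation under the interaction of $\mathscr A$ with $\mathcal M$. Write $T=KH$. **Theorem (tighter lower bound).** Let $S\ge6$, $A\ge2$, let $d$ be an integer with $S=3+\frac{A^d-1}{A-1}$, and let $H\ge3d$. Put $\bar H=\frac H3$ (a real number, not necessarily an integer) and $\bar L=(1-\frac1A)(S-3)+\frac1A$. Then for every $\beta>0$, every $K\ge2\exp(\beta(H-\bar H-d))\,\bar H\bar LA$ and every algorithm $\mathscr A$ for $K$ episodes, there are an MDP $\mathcal M$ with $S$ states, $A$ actions and horizon $H$, and a state $s_1$, such that, when every episode starts in $s_1$, $$\mathbb E[\mathrm{Regret}(\mathscr A,\mathcal M,K)]\ \ge\ \frac1{72\sqrt6}\cdot\frac{\exp(\beta H/6)-1}{\beta H}\cdot H\sqrt{SAT}.$$ Moreover, for fixed $S,A,H,K$, as $\beta\to0^+$ the right-hand side converges to $\frac1{432\sqrt6}H\sqrt{SAT}$, i.e. it recovers the order $H\sqrt{SAT}$ of the risk-neutral lower bound. -/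

import Mathlib

namespace RiskMDP

/-- Reward functions `r_h(s, a)`; the steps `h = 1, …, H` are indexed by `Fin H`, from `0`. -/
abbrev Reward (𝒮 𝒜 : Type*) (H : ℕ) := Fin H → 𝒮 → 𝒜 → ℝ

/-- A deterministic Markov policy `π = (π_h)_h`. -/
abbrev Policy (𝒮 𝒜 : Type*) (H : ℕ) := Fin H → 𝒮 → 𝒜

/-- The trajectory `(s_1, a_1, …, s_H, a_H)` of one episode. -/
abbrev Trajectory (𝒮 𝒜 : Type*) (H : ℕ) := Fin H → 𝒮 × 𝒜

/-- An episodic MDP with horizon `H`: transition kernels `P_h(s' | s, a) = trans h s a s'` and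
deterministic rewards in `[0, 1]`. -/
structure EpisodicMDP (𝒮 𝒜 : Type*) [Fintype 𝒮] (H : ℕ) where
  trans : Fin H → 𝒮 → 𝒜 → 𝒮 → ℝ
  trans_nonneg : ∀ h s a s', 0 ≤ trans h s a s'
  trans_sum : ∀ h s a, ∑ s', trans h s a s' = 1
  reward : Reward 𝒮 𝒜 H
  reward_nonneg : ∀ h s a, 0 ≤ reward h s a
  reward_le_one : ∀ h s a, reward h s a ≤ 1

/-- A learning algorithm for `K` episodes. At the start of episode `k` it chooses a policy from the
trajectories of the earlier episodes; it also knows the reward functions. -/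
abbrev Algorithm (𝒮 𝒜 : Type*) (H K : ℕ) :=
  Reward 𝒮 𝒜 H → (k : Fin K) → (Fin (k : ℕ) → Trajectory 𝒮 𝒜 H) → Policy 𝒮 𝒜 H

noncomputable section

variable {𝒮 𝒜 : Type*} [Fintype 𝒮] [DecidableEq 𝒮] [Fintype 𝒜] [DecidableEq 𝒜] {H K : ℕ}

/-- The probability of the state at step `h` of the trajectory `τ`, given the earlier steps: the
first state is `s₁`, every later one is drawn from the kernel of the step before it. -/
def stateProb (M : EpisodicMDP 𝒮 𝒜 H) (s₁ : 𝒮) (τ : Trajectory 𝒮 𝒜 H) (h : Fin H) : ℝ :=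
  if (h : ℕ) = 0 then (if (τ h).1 = s₁ then 1 else 0)
  else
    let g : Fin H := ⟨(h : ℕ) - 1, (Nat.sub_le _ _).trans_lt h.isLt⟩
    M.trans g (τ g).1 (τ g).2 (τ h).1

/-- The probability of the action at step `h` of `τ`, given the state: it is `π_h(s_h)`. -/
def actionProb (π : Policy 𝒮 𝒜 H) (τ : Trajectory 𝒮 𝒜 H) (h : Fin H) : ℝ :=
  if (τ h).2 = π h (τ h).1 then 1 else 0

/-- The probability of the trajectory `τ` when `π` is followed from `s₁`. -/
def trajProb (M : EpisodicMDP 𝒮 𝒜 H) (π : Policy 𝒮 𝒜 H) (s₁ : 𝒮)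
    (τ : Trajectory 𝒮 𝒜 H) : ℝ :=
  ∏ h : Fin H, stateProb M s₁ τ h * actionProb π τ h

/-- The return `∑_h r_h(s_h, a_h)` of a trajectory. -/
def episodeReturn (M : EpisodicMDP 𝒮 𝒜 H) (τ : Trajectory 𝒮 𝒜 H) : ℝ :=
  ∑ h : Fin H, M.reward h (τ h).1 (τ h).2

/-- The entropic risk measure `U_β(X) = (1/β) log E[exp(β X)]` of a random variable `X` on a
finite probability space with point masses `w`. -/
def entRM {Ω : Type*} [Fintype Ω] (β : ℝ) (w : Ω → ℝ) (X : Ω → ℝ) : ℝ :=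
  1 / β * Real.log (∑ ω, w ω * Real.exp (β * X ω))

/-- The value `V^π_1(s₁)`: the entropic risk measure of the return of `π` from `s₁`. -/
def value (β : ℝ) (M : EpisodicMDP 𝒮 𝒜 H) (π : Policy 𝒮 𝒜 H) (s₁ : 𝒮) : ℝ :=
  entRM β (trajProb M π s₁) (episodeReturn M)

/-- The optimal value `V^*_1(s₁) = max_π V^π_1(s₁)`; there are finitely many policies. -/
def optValue (β : ℝ) (M : EpisodicMDP 𝒮 𝒜 H) (s₁ : 𝒮) : ℝ :=
  ⨆ π : Policy 𝒮 𝒜 H, value β M π s₁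

/-- The policy of episode `k`, chosen from the trajectories of the episodes before `k` in the
history `ω` of all `K` episodes. -/
def policyAt (M : EpisodicMDP 𝒮 𝒜 H) (alg : Algorithm 𝒮 𝒜 H K)
    (ω : Fin K → Trajectory 𝒮 𝒜 H) (k : Fin K) : Policy 𝒮 𝒜 H :=
  alg M.reward k (fun j : Fin (k : ℕ) => ω (Fin.castLE k.isLt.le j))

/-- The probability of the history `ω` of all `K` episodes when `alg` interacts with `M` and
episode `k` starts in the state `init k`. -/
def historyProb (M : EpisodicMDP 𝒮 𝒜 H) (alg : Algorithm 𝒮 𝒜 H K) (init : Fin K → 𝒮)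
    (ω : Fin K → Trajectory 𝒮 𝒜 H) : ℝ :=
  ∏ k : Fin K, trajProb M (policyAt M alg ω k) (init k) (ω k)

/-- The regret `∑_k (V^*_1(s_1^k) - V^{π^k}_1(s_1^k))` on the history `ω`. -/
def regret (β : ℝ) (M : EpisodicMDP 𝒮 𝒜 H) (alg : Algorithm 𝒮 𝒜 H K) (init : Fin K → 𝒮)
    (ω : Fin K → Trajectory 𝒮 𝒜 H) : ℝ :=
  ∑ k : Fin K, (optValue β M (init k) - value β M (policyAt M alg ω k) (init k))

/-- The expected regret of `alg` interacting with `M` for `K` episodes. -/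
def expectedRegret (β : ℝ) (M : EpisodicMDP 𝒮 𝒜 H) (alg : Algorithm 𝒮 𝒜 H K)
    (init : Fin K → 𝒮) : ℝ :=
  ∑ ω : Fin K → Trajectory 𝒮 𝒜 H, historyProb M alg init ω * regret β M alg init ω

/-- The lower bound `(1/(72√6)) · (exp(βH/6) - 1)/(βH) · H √(S A T)` with `T = K H`. -/
def lowerBound (S A H K : ℕ) (β : ℝ) : ℝ :=
  1 / (72 * Real.sqrt 6) * ((Real.exp (β * H / 6) - 1) / (β * H)) * H *
    Real.sqrt (S * A * (K * H))

end

end RiskMDP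

/-! The hard instance is a multi-armed bandit in disguise. Starting from a word, the agent
overwrites its letters one per step with its first actions, then waits with the action `w` until it
pulls an arm, which consists of a step, a word and an action. The pull leads to an absorbing good
state with a small probability and otherwise to an absorbing bad one. Every policy is deterministic
and is forced to pull by the end of the waiting window, so an episode is a single Bernoulli draw
(`trajProb_trajOf`, `eq_trajOf_of_trajProb_ne_zero`) and the value is `(1/β) log (1 + q (exp (βG) -
1))`, where `q` is the success probability and `G` the total reward in the good state
(`value_hardMDP`).

All arms have success probability `p`, except a hidden one with `p + ε`. Rewards are the same for
every hidden arm, so knowing them does not help. If no arm is special, the `N` candidates share at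
most `K` pulls; by the chain rule for the divergence and a Hellinger bound, making one of them
special changes its expected number of pulls by little. Averaging over the candidates gives one that
is rarely pulled even when it is optimal (`exists_sum_visits_le`), and every other pull costs the
gap (`gap_le_optValue_sub_value`).

The exponential factor comes from making success rare. Put `R = exp (βG/2)` and `p = 1/(4R²)`: the
exponential moment stays bounded, so the gap is of order `ε (R² - 1)/β`, whereas the divergence per
pull is of order `ε²/p`. Thus `ε` may be of order `√(N/K)/R`, and the regret is of order `√(NK) (R -
1)/β` (`exists_gap`). Finally `G ≥ H/3` and `18 N ≥ S A H`. -/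

namespace RiskMDP

noncomputable section

/-! ### Adaptively generated sequences -/

section Adaptive

variable {Ω : Type*}

/-- The coordinates of `ω` before `k`. -/
def histPrefix {K : ℕ} (ω : Fin K → Ω) (k : Fin K) : Fin (k : ℕ) → Ω :=
  fun j => ω (Fin.castLE k.isLt.le j)

/-- The mass function of a sequence whose `k`-th entry is drawn from a kernel that depends on the
earlier entries. -/
def adaptiveProb {K : ℕ} (p : (k : Fin K) → (Fin (k : ℕ) → Ω) → Ω → ℝ) (ω : Fin K → Ω) : ℝ :=
  ∏ k, p k (histPrefix ω k) (ω k)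

theorem histPrefix_snoc_castSucc {K : ℕ} (ω : Fin K → Ω) (x : Ω) (k : Fin K) :
    histPrefix (Fin.snoc ω x : Fin (K + 1) → Ω) k.castSucc = histPrefix ω k := by
  funext j
  have : (Fin.castLE k.castSucc.isLt.le j : Fin (K + 1)) = (Fin.castLE k.isLt.le j).castSucc := rfl
  simp only [histPrefix]
  rw [this]
  exact Fin.snoc_castSucc (α := fun _ => Ω) _ _ _

theorem histPrefix_snoc_last {K : ℕ} (ω : Fin K → Ω) (x : Ω) :
    histPrefix (Fin.snoc ω x : Fin (K + 1) → Ω) (Fin.last K) = ω := by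
  funext j
  have : (Fin.castLE (Fin.last K).isLt.le j : Fin (K + 1)) = Fin.castSucc j := rfl
  simp only [histPrefix]
  rw [this]
  exact Fin.snoc_castSucc (α := fun _ => Ω) _ _ _

theorem adaptiveProb_snoc {K : ℕ} (p : (k : Fin (K + 1)) → (Fin (k : ℕ) → Ω) → Ω → ℝ)
    (ω : Fin K → Ω) (x : Ω) :
    adaptiveProb p (Fin.snoc ω x : Fin (K + 1) → Ω) =
      adaptiveProb (fun k : Fin K => p k.castSucc) ω * p (Fin.last K) ω x := by
  unfold adaptiveProb
  rw [Fin.prod_univ_castSucc]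
  congr 1
  · refine Finset.prod_congr rfl fun k _ => ?_
    rw [histPrefix_snoc_castSucc, Fin.snoc_castSucc (α := fun _ => Ω)]
  · rw [histPrefix_snoc_last, Fin.snoc_last]

theorem adaptiveProb_nonneg {K : ℕ} {p : (k : Fin K) → (Fin (k : ℕ) → Ω) → Ω → ℝ}
    (hp : ∀ k pre x, 0 ≤ p k pre x) (ω : Fin K → Ω) : 0 ≤ adaptiveProb p ω :=
  Finset.prod_nonneg fun _ _ => hp _ _ _

variable [Fintype Ω]

theorem sum_fin_succ_eq_sum_snoc {K : ℕ} (F : (Fin (K + 1) → Ω) → ℝ) :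
    ∑ ω, F ω = ∑ ω : Fin K → Ω, ∑ x, F (Fin.snoc ω x) := by
  rw [← (Fin.snocEquiv (fun _ : Fin (K + 1) => Ω)).sum_comp, Fintype.sum_prod_type_right]
  rfl

theorem sum_adaptiveProb {K : ℕ} {p : (k : Fin K) → (Fin (k : ℕ) → Ω) → Ω → ℝ}
    (hp : ∀ k pre, ∑ x, p k pre x = 1) : ∑ ω, adaptiveProb p ω = 1 := by
  induction K with
  | zero => simp [adaptiveProb]
  | succ K ih =>
    simp only [sum_fin_succ_eq_sum_snoc, adaptiveProb_snoc, ← Finset.mul_sum, hp, mul_one]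
    exact ih fun k => hp k.castSucc

/-- The tower property. -/
theorem sum_adaptiveProb_mul_sum {K : ℕ} {p : (k : Fin K) → (Fin (k : ℕ) → Ω) → Ω → ℝ}
    (hp : ∀ k pre, ∑ x, p k pre x = 1) (f : (k : Fin K) → (Fin (k : ℕ) → Ω) → Ω → ℝ) :
    ∑ ω, adaptiveProb p ω * ∑ k, f k (histPrefix ω k) (ω k) =
      ∑ ω, adaptiveProb p ω *
        ∑ k, ∑ x, p k (histPrefix ω k) x * f k (histPrefix ω k) x := by
  induction K with
  | zero => simp
  | succ K ih =>
    have ih' := ih (p := fun k : Fin K => p k.castSucc) (fun k => hp k.castSucc)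
      (fun k => f k.castSucc)
    simp only [sum_fin_succ_eq_sum_snoc, adaptiveProb_snoc, Fin.sum_univ_castSucc,
      histPrefix_snoc_castSucc, histPrefix_snoc_last, Fin.snoc_castSucc (α := fun _ => Ω),
      Fin.snoc_last, mul_add, Finset.sum_add_distrib]
    congr 1
    · calc _ = ∑ ω : Fin K → Ω, adaptiveProb (fun k : Fin K => p k.castSucc) ω *
            ∑ k : Fin K, f k.castSucc (histPrefix ω k) (ω k) := by
            refine Finset.sum_congr rfl fun ω _ => ?_
            rw [← Finset.sum_mul, ← Finset.mul_sum, hp, mul_one]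
        _ = _ := by
            rw [ih']
            refine Finset.sum_congr rfl fun ω _ => ?_
            rw [← Finset.sum_mul, ← Finset.mul_sum, hp, mul_one]
    · refine Finset.sum_congr rfl fun ω _ => ?_
      rw [← Finset.sum_mul, ← Finset.mul_sum, hp, mul_one, Finset.mul_sum]
      exact Finset.sum_congr rfl fun x _ => mul_assoc _ _ _

end Adaptive

/-! ### Divergence, total variation and Bernoulli laws -/

section Divergence

variable {α : Type*} [Fintype α]

/-- The Kullback–Leibler divergence of mass functions on a finite type. -/
def klSum (P Q : α → ℝ) : ℝ := ∑ ω, P ω * Real.log (P ω / Q ω)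

/-- This is `log t ≤ t - 1` at `t = √q / √p`. Summed over the sample space, it bounds the squared
Hellinger distance by the divergence. -/
theorem two_mul_sub_sqrt_le_mul_log {p q : ℝ} (hp : 0 ≤ p) (hq : 0 ≤ q) (h : q = 0 → p = 0) :
    2 * (p - √p * √q) ≤ p * Real.log (p / q) := by
  rcases hp.eq_or_lt with rfl | hp
  · simp
  have hq : 0 < q := hq.lt_of_ne fun h0 => hp.ne' (h h0.symm)
  have hsp : 0 < √p := Real.sqrt_pos.2 hp
  have hsq : 0 < √q := Real.sqrt_pos.2 hq
  have h1 : Real.log (√q / √p) ≤ √q / √p - 1 := Real.log_le_sub_one_of_pos (div_pos hsq hsp)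
  have h2 : Real.log (p / q) = -2 * Real.log (√q / √p) := by
    rw [Real.log_div hp.ne' hq.ne', Real.log_div hsq.ne' hsp.ne', Real.log_sqrt hp.le,
      Real.log_sqrt hq.le]
    ring
  have h3 : p * (√q / √p) = √p * √q := by
    rw [mul_div_assoc', div_eq_iff hsp.ne']
    nlinarith [Real.mul_self_sqrt hp.le]
  rw [h2]
  nlinarith

/-- A bound for the total variation distance by the divergence, tested on a bounded function. -/
theorem sum_mul_sub_sum_mul_le {P Q g : α → ℝ} {B : ℝ} (hP : ∀ ω, 0 ≤ P ω) (hQ : ∀ ω, 0 ≤ Q ω)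
    (hP1 : ∑ ω, P ω = 1) (hQ1 : ∑ ω, Q ω = 1) (hPQ : ∀ ω, Q ω = 0 → P ω = 0)
    (hg : ∀ ω, 0 ≤ g ω) (hgB : ∀ ω, g ω ≤ B) (hB : 0 ≤ B) :
    ∑ ω, Q ω * g ω - ∑ ω, P ω * g ω ≤ B * √(klSum P Q) := by
  have hH : ∑ ω, (√(Q ω) - √(P ω)) ^ 2 ≤ klSum P Q := by
    have h1 : ∀ ω, (√(Q ω) - √(P ω)) ^ 2 = (Q ω - P ω) + 2 * (P ω - √(P ω) * √(Q ω)) := by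
      intro ω
      nlinarith [Real.mul_self_sqrt (hP ω), Real.mul_self_sqrt (hQ ω)]
    calc _ = ∑ ω, 2 * (P ω - √(P ω) * √(Q ω)) := by
          simp only [h1, Finset.sum_add_distrib, Finset.sum_sub_distrib, hP1, hQ1]
          ring
      _ ≤ _ := Finset.sum_le_sum fun ω _ => two_mul_sub_sqrt_le_mul_log (hP ω) (hQ ω) (hPQ ω)
  have hkl : 0 ≤ klSum P Q := (Finset.sum_nonneg fun ω _ => sq_nonneg _).trans hH
  -- `P` and `Q` have the same mass, so `g` may be centred at `B / 2`, which halves its sup norm.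
  -- This yields the constant `B` in the Cauchy–Schwarz step.
  have hS : ∑ ω, ((√(Q ω) + √(P ω)) * (g ω - B / 2)) ^ 2 ≤ B ^ 2 := by
    calc _ ≤ ∑ ω, (2 * (Q ω + P ω)) * (B / 2) ^ 2 := by
          refine Finset.sum_le_sum fun ω _ => ?_
          rw [mul_pow]
          have h1 : (√(Q ω) + √(P ω)) ^ 2 ≤ 2 * (Q ω + P ω) := by
            nlinarith [Real.mul_self_sqrt (hP ω), Real.mul_self_sqrt (hQ ω),
              sq_nonneg (√(Q ω) - √(P ω))]
          have h2 : (g ω - B / 2) ^ 2 ≤ (B / 2) ^ 2 := by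
            nlinarith [hg ω, hgB ω, mul_nonneg (hg ω) (sub_nonneg.2 (hgB ω))]
          exact mul_le_mul h1 h2 (sq_nonneg _) (by linarith [hP ω, hQ ω])
      _ = B ^ 2 := by
          rw [← Finset.sum_mul, ← Finset.mul_sum, Finset.sum_add_distrib, hP1, hQ1]
          ring
  have hE : ∑ ω, Q ω * g ω - ∑ ω, P ω * g ω =
      ∑ ω, (√(Q ω) - √(P ω)) * ((√(Q ω) + √(P ω)) * (g ω - B / 2)) := by
    have h1 : ∀ ω, (√(Q ω) - √(P ω)) * ((√(Q ω) + √(P ω)) * (g ω - B / 2)) =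
        Q ω * g ω - P ω * g ω - (Q ω - P ω) * (B / 2) := by
      intro ω
      linear_combination (g ω - B / 2) * (Real.mul_self_sqrt (hQ ω) - Real.mul_self_sqrt (hP ω))
    simp only [h1, Finset.sum_sub_distrib, ← Finset.sum_mul, hP1, hQ1]
    ring
  rw [hE]
  refine (Real.sum_mul_le_sqrt_mul_sqrt _ _ _).trans ?_
  rw [mul_comm B]
  refine mul_le_mul (Real.sqrt_le_sqrt hH) ?_ (Real.sqrt_nonneg _) (Real.sqrt_nonneg _)
  exact (Real.sqrt_le_sqrt hS).trans_eq (Real.sqrt_sq hB)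

/-- The chain rule. -/
theorem klSum_adaptiveProb {Ω : Type*} [Fintype Ω] {K : ℕ}
    {p q : (k : Fin K) → (Fin (k : ℕ) → Ω) → Ω → ℝ} (hp : ∀ k pre, ∑ x, p k pre x = 1)
    (hpq : ∀ k pre x, q k pre x = 0 → p k pre x = 0) :
    klSum (adaptiveProb p) (adaptiveProb q) =
      ∑ ω, adaptiveProb p ω * ∑ k, klSum (p k (histPrefix ω k)) (q k (histPrefix ω k)) := by
  unfold klSum
  rw [← sum_adaptiveProb_mul_sum hp (fun k pre x => Real.log (p k pre x / q k pre x))]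
  refine Finset.sum_congr rfl fun ω _ => ?_
  -- The logarithm of the product splits only where the mass is nonzero; elsewhere both terms carry
  -- the factor zero.
  by_cases h0 : adaptiveProb p ω = 0
  · simp [h0]
  have hne : ∀ k, p k (histPrefix ω k) (ω k) ≠ 0 := fun k hk =>
    h0 (Finset.prod_eq_zero (Finset.mem_univ k) hk)
  congr 1
  rw [adaptiveProb, adaptiveProb, ← Finset.prod_div_distrib, Real.log_prod]
  exact fun k _ => div_ne_zero (hne k) fun h => hne k (hpq _ _ _ h)

/-- The mass function of a Bernoulli variable. -/
def bern (q : ℝ) (b : Bool) : ℝ := if b then q else 1 - q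

theorem bern_nonneg {q : ℝ} (h0 : 0 ≤ q) (h1 : q ≤ 1) (b : Bool) : 0 ≤ bern q b := by
  cases b <;> simp [bern, h0, h1]

theorem sum_bern (q : ℝ) : ∑ b, bern q b = 1 := by
  simp [bern]

/-- By `log t ≤ t - 1`, the divergence is at most the chi-square divergence. -/
theorem klSum_bern_le {p q : ℝ} (hp0 : 0 < p) (hp1 : p < 1) (hq0 : 0 < q) (hq1 : q < 1) :
    klSum (bern p) (bern q) ≤ (q - p) ^ 2 / (q * (1 - q)) := by
  have h1p : 0 < 1 - p := by linarith
  have h1q : 0 < 1 - q := by linarith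
  have h1 := mul_le_mul_of_nonneg_left (Real.log_le_sub_one_of_pos (div_pos hp0 hq0)) hp0.le
  have h2 := mul_le_mul_of_nonneg_left (Real.log_le_sub_one_of_pos (div_pos h1p h1q)) h1p.le
  calc klSum (bern p) (bern q)
      = p * Real.log (p / q) + (1 - p) * Real.log ((1 - p) / (1 - q)) := by simp [klSum, bern]
    _ ≤ p * (p / q - 1) + (1 - p) * ((1 - p) / (1 - q) - 1) := add_le_add h1 h2
    _ = _ := by
      field_simp
      ring

theorem klSum_self (P : α → ℝ) : klSum P P = 0 := by
  refine Finset.sum_eq_zero fun ω _ => ?_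
  by_cases h : P ω = 0 <;> simp [h]

end Divergence

/-! ### The hard instance: words, waiting and pulls -/

section HardInstance

variable {𝒮 𝒜 : Type*} {H : ℕ}

/-- The reduced states of the hard instance: words of length `D`, a good state `true` and a bad
state `false`. -/
abbrev Cell (𝒜 : Type*) (D : ℕ) := (Fin D → 𝒜) ⊕ Bool

/-- An arm of the hard instance: a step, a word and an action. -/
abbrev Arm (𝒜 : Type*) (D : ℕ) := ℕ × (Fin D → 𝒜) × 𝒜

/-- In the steps `D, …, D + W - 1`, every action but `w` pulls an arm, and in the last of them
`w` does so as well. -/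
def Pulls (D W : ℕ) (w : 𝒜) (h : ℕ) (a : 𝒜) : Prop := D ≤ h ∧ (a ≠ w ∨ D + W ≤ h + 1)

/-- The word with its `h`-th letter set to `a`; no change if there is no such letter. -/
def setLetter {D : ℕ} (x : Fin D → 𝒜) (h : ℕ) (a : 𝒜) : Fin D → 𝒜 :=
  fun i => if (i : ℕ) = h then a else x i

/-- The success probability of the action `a` in the cell `y` at step `h`; it is irrelevant unless
an arm is pulled. -/
def cellProb {D : ℕ} (q : Arm 𝒜 D → ℝ) (h : ℕ) (a : 𝒜) : Cell 𝒜 D → ℝ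
  | .inr _ => 0
  | .inl x => q (h, x, a)

theorem cellProb_mem {D : ℕ} {q : Arm 𝒜 D → ℝ} (hq : ∀ θ, q θ ∈ Set.Icc (0 : ℝ) 1) (h : ℕ)
    (a : 𝒜) (y : Cell 𝒜 D) : cellProb q h a y ∈ Set.Icc (0 : ℝ) 1 := by
  cases y with
  | inl x => exact hq _
  | inr c => simp [cellProb]

/-- The action of a policy at a cell, with the value `w` after the horizon. -/
def actionAt {D : ℕ} (w : 𝒜) (e : Cell 𝒜 D → 𝒮) (π : Policy 𝒮 𝒜 H) (h : ℕ) (y : Cell 𝒜 D) : 𝒜 :=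
  if hh : h < H then π ⟨h, hh⟩ (e y) else w

/-- The cell that results from `wordAt` if the outcome of the pull is `b`. -/
def cellAt {D : ℕ} (b : Bool) : Option (Fin D → 𝒜) → Cell 𝒜 D
  | none => .inr b
  | some x => .inl x

variable {D W : ℕ} {w : 𝒜} {e : Cell 𝒜 D → 𝒮} {f : 𝒮 → Cell 𝒜 D} {x₀ : Fin D → 𝒜}
  {π : Policy 𝒮 𝒜 H}

variable [DecidableEq 𝒜]

instance (D W : ℕ) (w : 𝒜) (h : ℕ) (a : 𝒜) : Decidable (Pulls D W w h a) := by
  unfold Pulls; infer_instance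

/-- The step of the hard instance, given the outcome `b` of the pull, if there is one. -/
def cellStep (D W : ℕ) (w : 𝒜) (h : ℕ) (a : 𝒜) (b : Bool) : Cell 𝒜 D → Cell 𝒜 D
  | .inr c => .inr c
  | .inl x => if Pulls D W w h a then .inr b else .inl (setLetter x h a)

/-- The word at step `h` when the policy `π` is followed from the word `x₀`, unless an arm has been
pulled before. -/
def wordAt {D : ℕ} (W : ℕ) (w : 𝒜) (e : Cell 𝒜 D → 𝒮) (x₀ : Fin D → 𝒜) (π : Policy 𝒮 𝒜 H) :
    ℕ → Option (Fin D → 𝒜)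
  | 0 => some x₀
  | h + 1 => (wordAt W w e x₀ π h).bind fun x =>
      if Pulls D W w h (actionAt w e π h (.inl x)) then none
      else some (setLetter x h (actionAt w e π h (.inl x)))

theorem cellAt_wordAt_succ (b : Bool) (h : ℕ) :
    cellAt b (wordAt W w e x₀ π (h + 1)) =
      cellStep D W w h (actionAt w e π h (cellAt b (wordAt W w e x₀ π h))) b
        (cellAt b (wordAt W w e x₀ π h)) := by
  rw [wordAt]
  cases hx : wordAt W w e x₀ π h with
  | none => rfl
  | some x =>
    by_cases hp : Pulls D W w h (actionAt w e π h (.inl x)) <;> simp [cellAt, cellStep, hp]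

theorem wordAt_eq_none_of_le {g h : ℕ} (hgh : g ≤ h) (hg : wordAt W w e x₀ π g = none) :
    wordAt W w e x₀ π h = none := by
  induction h, hgh using Nat.le_induction with
  | base => exact hg
  | succ h _ ih => rw [wordAt, ih]; rfl

/-- The policy `π` pulls the arm `θ`. -/
structure PullsArm (W : ℕ) (w : 𝒜) (e : Cell 𝒜 D → 𝒮) (x₀ : Fin D → 𝒜) (π : Policy 𝒮 𝒜 H)
    (θ : Arm 𝒜 D) : Prop where
  lt : θ.1 < D + W
  word : wordAt W w e x₀ π θ.1 = some θ.2.1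
  action : actionAt w e π θ.1 (.inl θ.2.1) = θ.2.2
  pulls : Pulls D W w θ.1 θ.2.2

theorem PullsArm.wordAt_succ {θ : Arm 𝒜 D} (hθ : PullsArm W w e x₀ π θ) :
    wordAt W w e x₀ π (θ.1 + 1) = none := by
  simp [wordAt, hθ.word, hθ.action, hθ.pulls]

theorem PullsArm.wordAt_eq_none {θ : Arm 𝒜 D} (hθ : PullsArm W w e x₀ π θ) {h : ℕ}
    (hh : θ.1 < h) : wordAt W w e x₀ π h = none :=
  wordAt_eq_none_of_le hh hθ.wordAt_succ

theorem PullsArm.wordAt_ne_none {θ : Arm 𝒜 D} (hθ : PullsArm W w e x₀ π θ) {h : ℕ}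
    (hh : h ≤ θ.1) : wordAt W w e x₀ π h ≠ none := fun h0 => by
  have := wordAt_eq_none_of_le hh h0
  simp [hθ.word] at this

theorem PullsArm.not_pulls {θ : Arm 𝒜 D} (hθ : PullsArm W w e x₀ π θ) {h : ℕ} {x : Fin D → 𝒜}
    (hx : wordAt W w e x₀ π h = some x) (hh : h ≠ θ.1) :
    ¬ Pulls D W w h (actionAt w e π h (.inl x)) := by
  intro hp
  have h1 : wordAt W w e x₀ π (h + 1) = none := by simp [wordAt, hx, hp]
  rcases hh.lt_or_gt with h2 | h2
  · exact hθ.wordAt_ne_none h2 h1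
  · simp [hθ.wordAt_eq_none h2] at hx

/-- In step `D + W - 1` every action pulls, so there is a first step after which the word is gone;
that step is the pull. -/
theorem exists_pullsArm (hW : 0 < W) (w : 𝒜) (e : Cell 𝒜 D → 𝒮) (x₀ : Fin D → 𝒜)
    (π : Policy 𝒮 𝒜 H) : ∃ θ, PullsArm W w e x₀ π θ := by
  have hex : ∃ h, wordAt W w e x₀ π (h + 1) = none := by
    refine ⟨D + W - 1, ?_⟩
    rw [wordAt]
    cases hx : wordAt W w e x₀ π (D + W - 1) with
    | none => rfl
    | some x =>
      rw [Option.bind_some, if_pos ⟨by omega, Or.inr (by omega)⟩]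
  classical
  have hT := Nat.find_spec hex
  have hmin := fun m => Nat.find_min (m := m) hex
  generalize Nat.find hex = T at hT hmin
  have hsome : wordAt W w e x₀ π T ≠ none := by
    cases T with
    | zero => simp [wordAt]
    | succ T => exact hmin T T.lt_succ_self
  obtain ⟨x, hx⟩ := Option.ne_none_iff_exists'.1 hsome
  have hp : Pulls D W w T (actionAt w e π T (.inl x)) := by
    by_contra hp
    simp [wordAt, hx, hp] at hT
  refine ⟨(T, x, actionAt w e π T (.inl x)), ?_, hx, rfl, hp⟩
  -- A later first pull would contradict minimality, since the word is already gone after step `D +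
  -- W - 1`.
  by_contra hlt
  refine hmin (D + W - 1) (by simp only at hlt; omega) ?_
  rw [wordAt]
  cases hx : wordAt W w e x₀ π (D + W - 1) with
  | none => rfl
  | some x =>
    rw [Option.bind_some, if_pos ⟨by omega, Or.inr (by omega)⟩]

/-- The trajectory of the policy `π` when the outcome of the pull is `b`. -/
def trajOf (W : ℕ) (w : 𝒜) (e : Cell 𝒜 D → 𝒮) (x₀ : Fin D → 𝒜) (π : Policy 𝒮 𝒜 H) (b : Bool) :
    Trajectory 𝒮 𝒜 H :=
  fun h => (e (cellAt b (wordAt W w e x₀ π h)), π h (e (cellAt b (wordAt W w e x₀ π h))))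

/-- The policy that aims at the arm `θ`. -/
def aimPolicy (H : ℕ) (w : 𝒜) (θ : Arm 𝒜 D) : Policy 𝒮 𝒜 H :=
  fun h _ => if hh : (h : ℕ) < D then θ.2.1 ⟨h, hh⟩ else if (h : ℕ) = θ.1 then θ.2.2 else w

/-- After `n` steps the first `n` letters agree with the target word, whatever `x₀` was. Playing `w`
then keeps the word, and it does not pull before step `θ.1`, which precedes or equals the last step
of the window. -/
theorem pullsArm_aimPolicy (hDW : D + W < H) (e : Cell 𝒜 D → 𝒮) (x₀ : Fin D → 𝒜) {θ : Arm 𝒜 D}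
    (h1 : D ≤ θ.1) (h2 : θ.1 < D + W) (h3 : θ.2.2 ≠ w) :
    PullsArm W w e x₀ (aimPolicy H w θ) θ := by
  have hact : ∀ n y, n < H → actionAt w e (aimPolicy H w θ) n y =
      if hh : n < D then θ.2.1 ⟨n, hh⟩ else if n = θ.1 then θ.2.2 else w := by
    intro n y hn
    simp [actionAt, hn, aimPolicy]
  have key : ∀ n, n ≤ θ.1 → ∃ x, wordAt W w e x₀ (aimPolicy H w θ) n = some x ∧
      ∀ i : Fin D, (i : ℕ) < n → x i = θ.2.1 i := by
    intro n
    induction n with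
    | zero => exact fun _ => ⟨x₀, rfl, by simp⟩
    | succ n ih =>
      intro hn
      obtain ⟨x, hx, hxi⟩ := ih (by omega)
      have hact' := hact n (.inl x) (by omega)
      have hnp : ¬ Pulls D W w n (actionAt w e (aimPolicy H w θ) n (.inl x)) := by
        rintro ⟨h4, h5 | h5⟩
        · rw [hact', dif_neg (by omega), if_neg (by omega)] at h5
          exact h5 rfl
        · omega
      refine ⟨_, by rw [wordAt, hx, Option.bind_some, if_neg hnp], fun i hi => ?_⟩
      unfold setLetter
      split_ifs with hin
      · subst hin
        rw [hact', dif_pos i.2]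
      · exact hxi i (by omega)
  obtain ⟨x, hx, hxi⟩ := key θ.1 le_rfl
  have hxe : x = θ.2.1 := funext fun i => hxi i (i.2.trans_le h1)
  refine ⟨h2, hxe ▸ hx, ?_, h1, Or.inl h3⟩
  rw [hact _ _ (by omega), dif_neg (by omega), if_pos rfl]

theorem trajOf_injective (he : Function.Injective e) (hDW : D + W < H) {θ : Arm 𝒜 D}
    (hθ : PullsArm W w e x₀ π θ) : Function.Injective (trajOf W w e x₀ π) := by
  intro b b' hbb
  have := he (congrArg Prod.fst (congrFun hbb ⟨D + W, hDW⟩))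
  simpa [hθ.wordAt_eq_none hθ.lt, cellAt] using this

/-! ### The MDP, the law of its trajectories and its values -/

variable [Fintype 𝒮] [DecidableEq 𝒮]

/-- The hard instance with success probabilities `q`. The cells are embedded into the state space
by `e`, with left inverse `f`; the reward is `r` in the good state from step `D + W` on. -/
def hardMDP (H : ℕ) {D : ℕ} (W : ℕ) (w : 𝒜) (e : Cell 𝒜 D → 𝒮) (f : 𝒮 → Cell 𝒜 D)
    (r : Set.Icc (0 : ℝ) 1) (q : Arm 𝒜 D → ℝ) (hq : ∀ θ, q θ ∈ Set.Icc (0 : ℝ) 1) :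
    EpisodicMDP 𝒮 𝒜 H where
  trans h s a s' := ∑ b, bern (cellProb q h a (f s)) b *
    if s' = e (cellStep D W w h a b (f s)) then 1 else 0
  trans_nonneg h s a s' := Finset.sum_nonneg fun b _ => mul_nonneg
    (bern_nonneg (cellProb_mem hq _ _ _).1 (cellProb_mem hq _ _ _).2 b) (by split_ifs <;> simp)
  trans_sum h s a := by
    rw [Finset.sum_comm]
    simp [sum_bern, -Fintype.univ_bool]
  reward h s _ := if D + W ≤ h ∧ f s = .inr true then r else 0
  reward_nonneg h s _ := by split_ifs <;> simp [r.2.1]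
  reward_le_one h s _ := by split_ifs <;> simp [r.2.2]

variable {r : Set.Icc (0 : ℝ) 1} {q : Arm 𝒜 D → ℝ} {hq : ∀ θ, q θ ∈ Set.Icc (0 : ℝ) 1}

/-- All transitions but the one at the pull are deterministic, so the only factor that can differ
from one is that of the state just after the pull. -/
theorem trajProb_trajOf (he : Function.Injective e) (hf : Function.LeftInverse f e)
    (hDW : D + W < H) {θ : Arm 𝒜 D}
    (hθ : PullsArm W w e x₀ π θ) (b : Bool) :
    trajProb (hardMDP H W w e f r q hq) π (e (.inl x₀)) (trajOf W w e x₀ π b) = bern (q θ) b := by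
  have hlt := hθ.lt
  unfold trajProb
  rw [Finset.prod_eq_single (⟨θ.1 + 1, by omega⟩ : Fin H)]
  · have hc : wordAt W w e x₀ π (θ.1 + 1) = none := hθ.wordAt_succ
    have ha : π ⟨θ.1, by omega⟩ (e (.inl θ.2.1)) = θ.2.2 := by
      simpa [actionAt, show θ.1 < H by omega] using hθ.action
    simp [stateProb, actionProb, trajOf, hardMDP, hf _, hθ.word, ha, hc, cellAt, cellProb, cellStep,
      hθ.pulls, he.eq_iff]
    cases b <;> simp
  · intro h _ hh
    have h1 : actionProb π (trajOf W w e x₀ π b) h = 1 := by simp [actionProb, trajOf]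
    rw [h1, mul_one]
    obtain ⟨n, hn⟩ := h
    cases n with
    | zero => simp [stateProb, trajOf, wordAt, cellAt]
    | succ n =>
      have hne : n ≠ θ.1 := fun h0 => hh (by simp [h0])
      have hn' : n < H := by omega
      have hact : ∀ y, actionAt w e π n y = π ⟨n, hn'⟩ (e y) := fun y => by simp [actionAt, hn']
      simp only [stateProb, trajOf, hardMDP, hf _, cellAt_wordAt_succ, hact, he.eq_iff]
      rw [if_neg (Nat.succ_ne_zero _)]
      simp only [Nat.add_sub_cancel]
      cases hx : wordAt W w e x₀ π n with
      | none => simp [cellAt, cellStep, sum_bern, -Fintype.univ_bool]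
      | some x =>
        have hnp := hθ.not_pulls hx hne
        rw [hact] at hnp
        simp [cellAt, cellStep, hnp, sum_bern, -Fintype.univ_bool]
  · simp

theorem eq_trajOf_of_trajProb_ne_zero (hf : Function.LeftInverse f e)
    (hDW : D + W < H) {θ : Arm 𝒜 D} (hθ : PullsArm W w e x₀ π θ) {τ : Trajectory 𝒮 𝒜 H}
    (hτ : trajProb (hardMDP H W w e f r q hq) π (e (.inl x₀)) τ ≠ 0) :
    ∃ b, τ = trajOf W w e x₀ π b := by
  have hlt := hθ.lt
  have hfac : ∀ h, stateProb (hardMDP H W w e f r q hq) (e (.inl x₀)) τ h ≠ 0 ∧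
      actionProb π τ h ≠ 0 := fun h =>
    mul_ne_zero_iff.1 (Finset.prod_ne_zero_iff.1 hτ h (Finset.mem_univ h))
  have hact : ∀ h, (τ h).2 = π h (τ h).1 := fun h => by
    by_contra h0
    exact (hfac h).2 (if_neg h0)
  have hzero : ∀ h : Fin H, (h : ℕ) = 0 → (τ h).1 = e (.inl x₀) := fun h h0 => by
    by_contra h1
    exact (hfac h).1 (by simp [stateProb, h0, h1])
  have hstep : ∀ (n : ℕ) (hn : n + 1 < H), ∃ b, (τ ⟨n + 1, hn⟩).1 =
      e (cellStep D W w n (π ⟨n, by omega⟩ (τ ⟨n, by omega⟩).1) b (f (τ ⟨n, by omega⟩).1)) := by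
    intro n hn
    by_contra! h0
    refine (hfac ⟨n + 1, hn⟩).1 ?_
    simp only [stateProb, hardMDP]
    rw [if_neg (Nat.succ_ne_zero _)]
    refine Finset.sum_eq_zero fun b _ => ?_
    rw [if_neg, mul_zero]
    have := h0 b
    rw [← hact] at this
    exact this
  -- The outcome is read off the transition at the pull; elsewhere the step does not depend on `b`.
  obtain ⟨b, hb⟩ := hstep θ.1 (by omega)
  refine ⟨b, ?_⟩
  have key : ∀ (n : ℕ) (hn : n < H), (τ ⟨n, hn⟩).1 = e (cellAt b (wordAt W w e x₀ π n)) := by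
    intro n
    induction n with
    | zero => exact fun hn => hzero _ rfl
    | succ n ih =>
      intro hn
      have hn' : n < H := by omega
      have hact' : ∀ y, actionAt w e π n y = π ⟨n, hn'⟩ (e y) := fun y => by simp [actionAt, hn']
      rw [cellAt_wordAt_succ]
      by_cases hne : n = θ.1
      · subst hne
        rw [hb, ih hn', hf, hact']
      obtain ⟨b', hb'⟩ := hstep n hn
      rw [hb', ih hn', hf, hact']
      cases hx : wordAt W w e x₀ π n with
      | none => rfl
      | some x =>
        have hnp := hθ.not_pulls hx hne
        rw [hact'] at hnp
        simp [cellAt, cellStep, hnp]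
  funext h
  refine Prod.ext (key h h.2) ?_
  rw [hact, key h h.2]
  rfl

theorem trajProb_nonneg (M : EpisodicMDP 𝒮 𝒜 H) (s : 𝒮) (τ : Trajectory 𝒮 𝒜 H) :
    0 ≤ trajProb M π s τ := by
  refine Finset.prod_nonneg fun h _ => mul_nonneg ?_ ?_
  · unfold stateProb
    split_ifs
    exacts [zero_le_one, le_rfl, M.trans_nonneg _ _ _ _]
  · unfold actionProb
    split_ifs <;> simp

theorem episodeReturn_trajOf (hf : Function.LeftInverse f e)
    {θ : Arm 𝒜 D} (hθ : PullsArm W w e x₀ π θ) (b : Bool) :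
    episodeReturn (hardMDP H W w e f r q hq) (trajOf W w e x₀ π b) =
      if b then ((H - (D + W) : ℕ) : ℝ) * r else 0 := by
  have h1 : ∀ h : Fin H, (hardMDP H W w e f r q hq).reward h (trajOf W w e x₀ π b h).1
      (trajOf W w e x₀ π b h).2 = if D + W ≤ (h : ℕ) then (if b then (r : ℝ) else 0) else 0 := by
    intro h
    simp only [hardMDP, trajOf, hf _]
    by_cases hh : D + W ≤ (h : ℕ)
    · rw [hθ.wordAt_eq_none (hθ.lt.trans_le hh)]
      cases b <;> simp [cellAt, hh]
    · simp [hh]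
  unfold episodeReturn
  simp only [h1]
  rw [Fin.sum_univ_eq_sum_range (fun h => if D + W ≤ h then (if b then (r : ℝ) else 0) else 0) H,
    ← Finset.sum_filter, Finset.sum_const]
  have : Finset.filter (fun h => D + W ≤ h) (Finset.range H) = Finset.Ico (D + W) H := by
    ext; simp; omega
  rw [this, Nat.card_Ico]
  cases b <;> simp

variable [Fintype 𝒜]

/-- Expectations over a trajectory of the hard instance are expectations over the outcome of the
pull. -/
theorem sum_eq_sum_bool (he : Function.Injective e) (hDW : D + W < H) {θ : Arm 𝒜 D}
    (hθ : PullsArm W w e x₀ π θ) (F : Trajectory 𝒮 𝒜 H → ℝ)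
    (hF : ∀ τ, F τ ≠ 0 → ∃ b, τ = trajOf W w e x₀ π b) :
    ∑ τ, F τ = ∑ b, F (trajOf W w e x₀ π b) := by
  classical
  rw [← Finset.sum_image (f := F) (g := trajOf W w e x₀ π)
    (fun b _ b' _ h => trajOf_injective he hDW hθ h)]
  refine (Finset.sum_subset (Finset.subset_univ _) fun τ _ hτ => ?_).symm
  by_contra h0
  obtain ⟨b, rfl⟩ := hF τ h0
  exact hτ (Finset.mem_image_of_mem _ (Finset.mem_univ b))

theorem sum_trajProb_mul (he : Function.Injective e) (hf : Function.LeftInverse f e)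
    (hDW : D + W < H) {θ : Arm 𝒜 D} (hθ : PullsArm W w e x₀ π θ) (F : Trajectory 𝒮 𝒜 H → ℝ) :
    ∑ τ, trajProb (hardMDP H W w e f r q hq) π (e (.inl x₀)) τ * F τ =
      ∑ b, bern (q θ) b * F (trajOf W w e x₀ π b) := by
  rw [sum_eq_sum_bool he hDW hθ]
  · simp only [trajProb_trajOf he hf hDW hθ]
  · exact fun τ hτ => eq_trajOf_of_trajProb_ne_zero hf hDW hθ (left_ne_zero_of_mul hτ)

theorem sum_trajProb (he : Function.Injective e) (hf : Function.LeftInverse f e)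
    (hDW : D + W < H) {θ : Arm 𝒜 D} (hθ : PullsArm W w e x₀ π θ) :
    ∑ τ, trajProb (hardMDP H W w e f r q hq) π (e (.inl x₀)) τ = 1 := by
  have := sum_trajProb_mul (r := r) (q := q) (hq := hq) he hf hDW hθ (fun _ => 1)
  simpa only [mul_one, sum_bern] using this

/-- For a fixed policy the trajectory carries the same information as the outcome of its pull. -/
theorem klSum_trajProb (he : Function.Injective e) (hf : Function.LeftInverse f e)
    (hDW : D + W < H) {θ : Arm 𝒜 D} (hθ : PullsArm W w e x₀ π θ)
    {q' : Arm 𝒜 D → ℝ} {hq' : ∀ θ, q' θ ∈ Set.Icc (0 : ℝ) 1} :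
    klSum (trajProb (hardMDP H W w e f r q hq) π (e (.inl x₀)))
      (trajProb (hardMDP H W w e f r q' hq') π (e (.inl x₀))) =
        klSum (bern (q θ)) (bern (q' θ)) := by
  rw [klSum, sum_trajProb_mul he hf hDW hθ]
  simp only [trajProb_trajOf he hf hDW hθ]
  rfl

theorem value_hardMDP (he : Function.Injective e) (hf : Function.LeftInverse f e)
    (hDW : D + W < H) {θ : Arm 𝒜 D} (hθ : PullsArm W w e x₀ π θ) (β : ℝ) :
    value β (hardMDP H W w e f r q hq) π (e (.inl x₀)) =
      1 / β * Real.log (1 + q θ * (Real.exp (β * (((H - (D + W) : ℕ) : ℝ) * r)) - 1)) := by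
  rw [value, entRM, sum_trajProb_mul he hf hDW hθ]
  simp only [episodeReturn_trajOf hf hθ]
  congr 2
  simp [bern]
  ring

end HardInstance

/-! ### Pull counts, change of measure and regret -/

section Regret

theorem div_le_log_sub_log {u v : ℝ} (hu : 0 < u) (hv : 0 < v) :
    (v - u) / v ≤ Real.log v - Real.log u := by
  have h := Real.log_le_sub_one_of_pos (div_pos hu hv)
  rw [Real.log_div hu.ne' hv.ne'] at h
  have : (v - u) / v = 1 - u / v := by field_simp
  linarith

variable {𝒮 𝒜 : Type*} [DecidableEq 𝒜] {H K : ℕ}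
  {D W : ℕ} {w : 𝒜} {e : Cell 𝒜 D → 𝒮} {f : 𝒮 → Cell 𝒜 D} {x₀ : Fin D → 𝒜}

/-- The success probabilities with the single optimal arm `θ`. -/
def starProb {D : ℕ} (p ε : ℝ) (θ η : Arm 𝒜 D) : ℝ := p + if η = θ then ε else 0

theorem starProb_mem {p ε : ℝ} (hp : 0 < p) (hε : 0 ≤ ε) (hpε : p + ε < 1) (θ η : Arm 𝒜 D) :
    starProb p ε θ η ∈ Set.Ioo (0 : ℝ) 1 := by
  unfold starProb
  constructor <;> split_ifs <;> linarith

/-- The arm that the policy `π` pulls. -/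
def armOf (hW : 0 < W) (w : 𝒜) (e : Cell 𝒜 D → 𝒮) (x₀ : Fin D → 𝒜) (π : Policy 𝒮 𝒜 H) : Arm 𝒜 D :=
  (exists_pullsArm hW w e x₀ π).choose

theorem pullsArm_armOf (hW : 0 < W) (w : 𝒜) (e : Cell 𝒜 D → 𝒮) (x₀ : Fin D → 𝒜)
    (π : Policy 𝒮 𝒜 H) : PullsArm W w e x₀ π (armOf hW w e x₀ π) :=
  (exists_pullsArm hW w e x₀ π).choose_spec

/-- The number of episodes in which the policies `a` pull the arm `θ`. -/
def visits (hW : 0 < W) (w : 𝒜) (e : Cell 𝒜 D → 𝒮) (x₀ : Fin D → 𝒜)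
    (a : (k : Fin K) → (Fin (k : ℕ) → Trajectory 𝒮 𝒜 H) → Policy 𝒮 𝒜 H)
    (θ : Arm 𝒜 D) (ω : Fin K → Trajectory 𝒮 𝒜 H) : ℝ :=
  ∑ k, if armOf hW w e x₀ (a k (histPrefix ω k)) = θ then 1 else 0

theorem visits_nonneg (hW : 0 < W)
    (a : (k : Fin K) → (Fin (k : ℕ) → Trajectory 𝒮 𝒜 H) → Policy 𝒮 𝒜 H)
    (θ : Arm 𝒜 D) (ω : Fin K → Trajectory 𝒮 𝒜 H) : 0 ≤ visits hW w e x₀ a θ ω :=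
  Finset.sum_nonneg fun _ _ => by split_ifs <;> simp

theorem visits_le (hW : 0 < W)
    (a : (k : Fin K) → (Fin (k : ℕ) → Trajectory 𝒮 𝒜 H) → Policy 𝒮 𝒜 H)
    (θ : Arm 𝒜 D) (ω : Fin K → Trajectory 𝒮 𝒜 H) : visits hW w e x₀ a θ ω ≤ K := by
  calc visits hW w e x₀ a θ ω ≤ ∑ _k : Fin K, (1 : ℝ) :=
        Finset.sum_le_sum fun _ _ => by split_ifs <;> simp
    _ = K := by simp

theorem sum_visits_le (hW : 0 < W)
    (a : (k : Fin K) → (Fin (k : ℕ) → Trajectory 𝒮 𝒜 H) → Policy 𝒮 𝒜 H)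
    (s : Finset (Arm 𝒜 D)) (ω : Fin K → Trajectory 𝒮 𝒜 H) :
    ∑ θ ∈ s, visits hW w e x₀ a θ ω ≤ K := by
  unfold visits
  rw [Finset.sum_comm]
  calc _ ≤ ∑ _k : Fin K, (1 : ℝ) := Finset.sum_le_sum fun _ _ => by
        rw [Finset.sum_ite_eq]
        split_ifs <;> simp
    _ = K := by simp

variable [Fintype 𝒮] [DecidableEq 𝒮]

/-- The law of the history when the policies `a` are used in the hard instance. -/
def histProb (x₀ : Fin D → 𝒜)
    (a : (k : Fin K) → (Fin (k : ℕ) → Trajectory 𝒮 𝒜 H) → Policy 𝒮 𝒜 H)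
    (M : EpisodicMDP 𝒮 𝒜 H) (e : Cell 𝒜 D → 𝒮) : (Fin K → Trajectory 𝒮 𝒜 H) → ℝ :=
  adaptiveProb fun k pre => trajProb M (a k pre) (e (.inl x₀))

theorem histProb_nonneg
    (a : (k : Fin K) → (Fin (k : ℕ) → Trajectory 𝒮 𝒜 H) → Policy 𝒮 𝒜 H)
    (M : EpisodicMDP 𝒮 𝒜 H) (ω : Fin K → Trajectory 𝒮 𝒜 H) : 0 ≤ histProb x₀ a M e ω :=
  adaptiveProb_nonneg (fun _ _ _ => trajProb_nonneg _ _ _) ω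

theorem trajProb_eq_zero_of_trajProb_eq_zero (he : Function.Injective e)
    (hf : Function.LeftInverse f e) (hDW : D + W < H) {r : Set.Icc (0 : ℝ) 1}
    {q q' : Arm 𝒜 D → ℝ} {hq : ∀ θ, q θ ∈ Set.Icc (0 : ℝ) 1}
    {hq' : ∀ θ, q' θ ∈ Set.Icc (0 : ℝ) 1} {π : Policy 𝒮 𝒜 H} {θ : Arm 𝒜 D}
    (hθ : PullsArm W w e x₀ π θ) (hq0 : q' θ ∈ Set.Ioo (0 : ℝ) 1) (τ : Trajectory 𝒮 𝒜 H)
    (h0 : trajProb (hardMDP H W w e f r q' hq') π (e (.inl x₀)) τ = 0) :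
    trajProb (hardMDP H W w e f r q hq) π (e (.inl x₀)) τ = 0 := by
  by_contra hne
  obtain ⟨b, rfl⟩ := eq_trajOf_of_trajProb_ne_zero hf hDW hθ hne
  rw [trajProb_trajOf he hf hDW hθ] at h0
  cases b
  · simp only [bern, Bool.false_eq_true, if_false] at h0
    linarith [hq0.2]
  · simp only [bern, if_true] at h0
    linarith [hq0.1]

variable [Fintype 𝒜]

/-- The arms that are candidates for the optimal one. -/
def starArms (D W : ℕ) (w : 𝒜) : Finset (Arm 𝒜 D) :=
  Finset.Ico D (D + W) ×ˢ (Finset.univ ×ˢ Finset.univ.erase w)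

theorem card_starArms (D W : ℕ) (w : 𝒜) :
    (starArms D W w).card = W * (Fintype.card 𝒜 ^ D * (Fintype.card 𝒜 - 1)) := by
  simp [starArms, Finset.card_product, Finset.card_erase_of_mem]

theorem mem_starArms {θ : Arm 𝒜 D} :
    θ ∈ starArms D W w ↔ (D ≤ θ.1 ∧ θ.1 < D + W) ∧ θ.2.2 ≠ w := by
  simp [starArms]

variable {r : Set.Icc (0 : ℝ) 1} {q q' : Arm 𝒜 D → ℝ} {hq : ∀ θ, q θ ∈ Set.Icc (0 : ℝ) 1}
  {hq' : ∀ θ, q' θ ∈ Set.Icc (0 : ℝ) 1}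

theorem sum_histProb (he : Function.Injective e) (hf : Function.LeftInverse f e) (hDW : D + W < H)
    (hW : 0 < W) (a : (k : Fin K) → (Fin (k : ℕ) → Trajectory 𝒮 𝒜 H) → Policy 𝒮 𝒜 H) :
    ∑ ω, histProb x₀ a (hardMDP H W w e f r q hq) e ω = 1 :=
  sum_adaptiveProb fun _ _ => sum_trajProb he hf hDW (pullsArm_armOf hW _ _ _ _)

/-- In the chain rule, an episode that pulls an arm other than `θ` has the same law in both
instances and contributes nothing. -/
theorem klSum_histProb (he : Function.Injective e) (hf : Function.LeftInverse f e)
    (hDW : D + W < H) (hW : 0 < W)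
    (a : (k : Fin K) → (Fin (k : ℕ) → Trajectory 𝒮 𝒜 H) → Policy 𝒮 𝒜 H)
    (hq0 : ∀ θ, q' θ ∈ Set.Ioo (0 : ℝ) 1) (θ : Arm 𝒜 D) (hqq : ∀ η, η ≠ θ → q' η = q η) :
    klSum (histProb x₀ a (hardMDP H W w e f r q hq) e)
      (histProb x₀ a (hardMDP H W w e f r q' hq') e) =
      (∑ ω, histProb x₀ a (hardMDP H W w e f r q hq) e ω * visits hW w e x₀ a θ ω) *
        klSum (bern (q θ)) (bern (q' θ)) := by
  unfold histProb
  rw [klSum_adaptiveProb (fun _ _ => sum_trajProb he hf hDW (pullsArm_armOf hW _ _ _ _))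
    (fun _ _ => trajProb_eq_zero_of_trajProb_eq_zero he hf hDW (pullsArm_armOf hW _ _ _ _) (hq0 _)),
    Finset.sum_mul]
  refine Finset.sum_congr rfl fun ω _ => ?_
  rw [mul_assoc]
  congr 1
  rw [visits, Finset.sum_mul]
  refine Finset.sum_congr rfl fun k _ => ?_
  rw [klSum_trajProb he hf hDW (pullsArm_armOf hW _ _ _ _)]
  split_ifs with h
  · rw [h, one_mul]
  · rw [hqq _ h, klSum_self, zero_mul]

/-- Changing the success probability of one arm changes the expected number of its pulls by little,
if it is rarely pulled. -/
theorem sum_visits_le_add (he : Function.Injective e) (hf : Function.LeftInverse f e)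
    (hDW : D + W < H) (hW : 0 < W)
    (a : (k : Fin K) → (Fin (k : ℕ) → Trajectory 𝒮 𝒜 H) → Policy 𝒮 𝒜 H)
    (hq0 : ∀ θ, q' θ ∈ Set.Ioo (0 : ℝ) 1) (θ : Arm 𝒜 D) (hqq : ∀ η, η ≠ θ → q' η = q η) :
    ∑ ω, histProb x₀ a (hardMDP H W w e f r q' hq') e ω * visits hW w e x₀ a θ ω ≤
      ∑ ω, histProb x₀ a (hardMDP H W w e f r q hq) e ω * visits hW w e x₀ a θ ω +
      K * √((∑ ω, histProb x₀ a (hardMDP H W w e f r q hq) e ω * visits hW w e x₀ a θ ω) *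
        klSum (bern (q θ)) (bern (q' θ))) := by
  rw [← klSum_histProb he hf hDW hW a hq0 θ hqq, ← sub_le_iff_le_add']
  refine sum_mul_sub_sum_mul_le (histProb_nonneg a _) (histProb_nonneg a _)
    (sum_histProb he hf hDW hW a) (sum_histProb he hf hDW hW a) ?_
    (visits_nonneg hW a θ) (visits_le hW a θ) (Nat.cast_nonneg K)
  intro ω h0
  rw [histProb, adaptiveProb] at h0 ⊢
  obtain ⟨k, _, hk⟩ := Finset.prod_eq_zero_iff.1 h0
  exact Finset.prod_eq_zero (Finset.mem_univ k) (trajProb_eq_zero_of_trajProb_eq_zero he hf hDW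
    (pullsArm_armOf hW _ _ _ _) (hq0 _) _ hk)

/-- Some optimal arm is pulled rarely. -/
theorem exists_sum_visits_le (he : Function.Injective e) (hf : Function.LeftInverse f e)
    (hDW : D + W < H) (hW : 0 < W)
    (a : (k : Fin K) → (Fin (k : ℕ) → Trajectory 𝒮 𝒜 H) → Policy 𝒮 𝒜 H)
    {p ε κ : ℝ} (hp : 0 < p) (hε : 0 ≤ ε) (hpε : p + ε < 1)
    (hκ : klSum (bern p) (bern (p + ε)) ≤ κ) (hκ0 : 0 ≤ κ) (hN : (starArms D W w).Nonempty) :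
    ∃ θ ∈ starArms D W w,
      ∑ ω, histProb x₀ a (hardMDP H W w e f r (starProb p ε θ)
        fun η => Set.Ioo_subset_Icc_self (starProb_mem hp hε hpε θ η)) e ω *
          visits hW w e x₀ a θ ω ≤
      K * (1 / ((starArms D W w).card : ℝ) + √(K * κ / ((starArms D W w).card : ℝ))) := by
  set N : ℝ := ((starArms D W w).card : ℝ) with hNdef
  have hN0 : 0 < N := Nat.cast_pos.2 hN.card_pos
  have hK : (0 : ℝ) ≤ K := Nat.cast_nonneg K
  have hmem : ∀ _ : Arm 𝒜 D, p ∈ Set.Icc (0 : ℝ) 1 := fun _ => ⟨hp.le, by linarith⟩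
  set P₀ := histProb x₀ a (hardMDP H W w e f r (fun _ => p) hmem) e with hP₀
  set v : Arm 𝒜 D → ℝ := fun θ => ∑ ω, P₀ ω * visits hW w e x₀ a θ ω with hv
  have hv0 : ∀ θ, 0 ≤ v θ := fun θ =>
    Finset.sum_nonneg fun ω _ => mul_nonneg (histProb_nonneg a _ ω) (visits_nonneg hW a θ ω)
  have hvsum : ∑ θ ∈ starArms D W w, v θ ≤ K := by
    rw [hv, Finset.sum_comm]
    calc _ ≤ ∑ ω, P₀ ω * K := by
          refine Finset.sum_le_sum fun ω _ => ?_
          rw [← Finset.mul_sum]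
          exact mul_le_mul_of_nonneg_left (sum_visits_le hW a _ ω) (histProb_nonneg a _ ω)
      _ = K := by rw [← Finset.sum_mul, hP₀, sum_histProb he hf hDW hW a, one_mul]
  have hstep : ∀ θ, ∑ ω, histProb x₀ a (hardMDP H W w e f r (starProb p ε θ)
        fun η => Set.Ioo_subset_Icc_self (starProb_mem hp hε hpε θ η)) e ω *
          visits hW w e x₀ a θ ω ≤ v θ + K * √(v θ * κ) := by
    intro θ
    refine (sum_visits_le_add (q := fun _ => p) (hq := hmem) he hf hDW hW a
      (starProb_mem hp hε hpε θ) θ fun η h => by simp [starProb, h]).trans ?_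
    have : starProb p ε θ θ = p + ε := by simp [starProb]
    rw [this]
    gcongr
    exact hv0 θ
  -- Cauchy–Schwarz against the constant one, with the total number of pulls at most `K`.
  have hcs : ∑ θ ∈ starArms D W w, √(v θ * κ) ≤ N * √(K * κ / N) := by
    have h1 := Real.sum_mul_le_sqrt_mul_sqrt (starArms D W w) (fun θ => √(v θ * κ)) fun _ => 1
    simp only [mul_one, Real.sq_sqrt (mul_nonneg (hv0 _) hκ0), one_pow, Finset.sum_const,
      nsmul_eq_mul, ← hNdef, ← Finset.sum_mul] at h1
    refine h1.trans ?_
    have h2 : N * √(K * κ / N) = √(K * κ) * √N := by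
      rw [Real.sqrt_div' _ hN0.le, mul_div_assoc', div_eq_iff (Real.sqrt_pos.2 hN0).ne', mul_assoc,
        Real.mul_self_sqrt hN0.le, mul_comm]
    rw [h2]
    gcongr
  -- Some candidate does no worse than the average over all candidates.
  refine Finset.exists_le_of_sum_le hN ?_
  calc _ ≤ ∑ θ ∈ starArms D W w, (v θ + K * √(v θ * κ)) := Finset.sum_le_sum fun θ _ => hstep θ
    _ ≤ K + K * (N * √(K * κ / N)) := by
        rw [Finset.sum_add_distrib, ← Finset.mul_sum]
        gcongr
    _ = _ := by
        rw [Finset.sum_const, nsmul_eq_mul, ← hNdef]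
        field_simp

/-- The policy aiming at `θ` is a competitor for the optimum, and `log v - log u ≥ (v - u) / v`
bounds the difference of the two logarithms. -/
theorem gap_le_optValue_sub_value (he : Function.Injective e) (hf : Function.LeftInverse f e)
    (hDW : D + W < H) (hW : 0 < W) {p ε β : ℝ} (hp : 0 < p) (hε : 0 ≤ ε) (hpε : p + ε < 1)
    (hβ : 0 < β) {θ : Arm 𝒜 D} (hθ : θ ∈ starArms D W w) {X : ℝ}
    (hX : X = Real.exp (β * (((H - (D + W) : ℕ) : ℝ) * r)) - 1) (π : Policy 𝒮 𝒜 H)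
    {M : EpisodicMDP 𝒮 𝒜 H} (hM : M = hardMDP H W w e f r (starProb p ε θ)
      fun η => Set.Ioo_subset_Icc_self (starProb_mem hp hε hpε θ η)) :
    1 / β * (ε * X / (1 + (p + ε) * X)) * (1 - if armOf hW w e x₀ π = θ then 1 else 0) ≤
      optValue β M (e (.inl x₀)) - value β M π (e (.inl x₀)) := by
  have hbdd : BddAbove (Set.range fun π : Policy 𝒮 𝒜 H => value β M π (e (.inl x₀))) :=
    (Set.finite_range _).bddAbove
  have hX0 : 0 ≤ X := by
    rw [hX, sub_nonneg]
    exact Real.one_le_exp (by have := r.2.1; positivity)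
  split_ifs with h
  · rw [sub_self, mul_zero, sub_nonneg]
    exact le_ciSup hbdd π
  · obtain ⟨⟨h1, h2⟩, h3⟩ := mem_starArms.1 hθ
    refine le_trans ?_ (sub_le_sub_right (le_ciSup hbdd (aimPolicy H w θ)) _)
    simp only [hM]
    rw [value_hardMDP he hf hDW (pullsArm_aimPolicy hDW e x₀ h1 h2 h3),
      value_hardMDP he hf hDW (pullsArm_armOf hW w e x₀ π), ← hX, ← mul_sub, sub_zero, mul_one]
    have hs1 : starProb p ε θ θ = p + ε := by simp [starProb]
    have hs2 : starProb p ε θ (armOf hW w e x₀ π) = p := by simp [starProb, h]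
    rw [hs1, hs2]
    refine mul_le_mul_of_nonneg_left ?_ (by positivity)
    have := div_le_log_sub_log (u := 1 + p * X) (v := 1 + (p + ε) * X) (by positivity)
      (by positivity)
    refine le_trans (le_of_eq ?_) this
    ring

theorem exists_le_expectedRegret (he : Function.Injective e) (hf : Function.LeftInverse f e)
    (hDW : D + W < H) (hW : 0 < W) (alg : Algorithm 𝒮 𝒜 H K) (x₀ : Fin D → 𝒜)
    (r : Set.Icc (0 : ℝ) 1) {p ε κ β X : ℝ}
    (hp : 0 < p) (hε : 0 ≤ ε) (hpε : p + ε < 1) (hβ : 0 < β)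
    (hκ : klSum (bern p) (bern (p + ε)) ≤ κ) (hκ0 : 0 ≤ κ) (hN : (starArms D W w).Nonempty)
    (hX : X = Real.exp (β * (((H - (D + W) : ℕ) : ℝ) * r)) - 1) :
    ∃ M : EpisodicMDP 𝒮 𝒜 H, 1 / β * (ε * X / (1 + (p + ε) * X)) *
      (K * (1 - 1 / ((starArms D W w).card : ℝ) - √(K * κ / ((starArms D W w).card : ℝ)))) ≤
        expectedRegret β M alg fun _ => e (.inl x₀) := by
  have hmem : ∀ _ : Arm 𝒜 D, p ∈ Set.Icc (0 : ℝ) 1 := fun _ => ⟨hp.le, by linarith⟩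
  -- The rewards do not involve the success probabilities, so the algorithm acts through this same
  -- family `a` in every instance.
  set a := alg (hardMDP H W w e f r (fun _ => p) hmem).reward
  obtain ⟨θ, hθ, hle⟩ := exists_sum_visits_le (r := r) (x₀ := x₀) he hf hDW hW a hp hε hpε hκ hκ0 hN
  generalize hM : hardMDP H W w e f r (starProb p ε θ)
    (fun η => Set.Ioo_subset_Icc_self (starProb_mem hp hε hpε θ η)) = M at hle
  have hrew : alg M.reward = a := by rw [← hM]; rfl
  have hX0 : 0 ≤ X := by
    rw [hX, sub_nonneg]
    exact Real.one_le_exp (by have := r.2.1; positivity)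
  set g := 1 / β * (ε * X / (1 + (p + ε) * X)) with hg
  have hg0 : 0 ≤ g := by positivity
  refine ⟨M, ?_⟩
  have hhist : ∀ ω, historyProb M alg (fun _ => e (.inl x₀)) ω = histProb x₀ a M e ω := by
    intro ω
    rw [← hrew]
    rfl
  have hreg : ∀ ω, g * (K - visits hW w e x₀ a θ ω) ≤
      regret β M alg (fun _ => e (.inl x₀)) ω := by
    intro ω
    have : g * (K - visits hW w e x₀ a θ ω) = ∑ k : Fin K,
        g * (1 - if armOf hW w e x₀ (a k (histPrefix ω k)) = θ then 1 else 0) := by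
      rw [← Finset.mul_sum, Finset.sum_sub_distrib]
      simp [visits]
    rw [this, ← hrew]
    exact Finset.sum_le_sum fun k _ =>
      gap_le_optValue_sub_value he hf hDW hW hp hε hpε hβ hθ hX _ hM.symm
  have hsum : ∑ ω, histProb x₀ a M e ω = 1 := by
    rw [← hM]
    exact sum_histProb he hf hDW hW a
  calc _ ≤ g * (K - ∑ ω, histProb x₀ a M e ω * visits hW w e x₀ a θ ω) := by
        refine mul_le_mul_of_nonneg_left ?_ hg0
        linarith
    _ = ∑ ω, histProb x₀ a M e ω * (g * (K - visits hW w e x₀ a θ ω)) := by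
        have : ∀ ω, histProb x₀ a M e ω * (g * (K - visits hW w e x₀ a θ ω)) =
            g * (histProb x₀ a M e ω * K - histProb x₀ a M e ω * visits hW w e x₀ a θ ω) :=
          fun ω => by ring
        simp only [this, ← Finset.mul_sum, Finset.sum_sub_distrib, ← Finset.sum_mul, hsum, one_mul]
    _ ≤ _ := Finset.sum_le_sum fun ω _ => by
        rw [hhist]
        exact mul_le_mul_of_nonneg_left (hreg ω) (histProb_nonneg a M ω)

end Regret

/-! ### The limit of small risk and the choice of parameters -/

theorem tendsto_lowerBound (S A H K : ℕ) (hH : H ≠ 0) :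
    Filter.Tendsto (fun β : ℝ => lowerBound S A H K β) (nhdsWithin 0 (Set.Ioi 0))
      (nhds (1 / (432 * Real.sqrt 6) * H * Real.sqrt (S * A * (K * H)))) := by
  have hH' : (H : ℝ) ≠ 0 := Nat.cast_ne_zero.2 hH
  -- The quotient in the bound is a difference quotient at zero divided by `H`; it tends to `1/6`,
  -- and `432 = 72 * 6`.
  have hd : HasDerivAt (fun β : ℝ => Real.exp (β * H / 6)) ((H : ℝ) / 6) 0 := by
    have h1 : HasDerivAt (fun β : ℝ => β * H / 6) ((H : ℝ) / 6) 0 := by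
      simpa using ((hasDerivAt_id (0 : ℝ)).mul_const (H : ℝ)).div_const 6
    simpa using h1.exp
  have ht := (hasDerivAt_iff_tendsto_slope_zero.1 hd).mono_left
    (nhdsWithin_mono 0 fun x (hx : 0 < x) => hx.ne')
  have h2 : Filter.Tendsto (fun β : ℝ => lowerBound S A H K β) (nhdsWithin 0 (Set.Ioi 0))
      (nhds (1 / (72 * Real.sqrt 6) * ((H : ℝ) / 6 / H) * H * Real.sqrt (S * A * (K * H)))) := by
    refine ((((ht.div_const (H : ℝ)).const_mul _).mul_const _).mul_const _).congr fun β => ?_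
    simp only [lowerBound, zero_add, zero_mul, zero_div, Real.exp_zero, smul_eq_mul]
    congr 3
    ring
  convert h2 using 2
  field_simp
  ring

/-- The choice of the success probability `p = 1 / (4 R²)` and of the gap
`ε = √(N / K) / (8 R)`. -/
theorem exists_gap {N K R : ℝ} (hN : 4 ≤ N) (hR : 1 ≤ R) (hK : N * R ^ 2 ≤ K) :
    ∃ p ε κ : ℝ, 0 < p ∧ 0 ≤ ε ∧ p + ε < 1 ∧ klSum (bern p) (bern (p + ε)) ≤ κ ∧ 0 ≤ κ ∧
      2 / 55 * √(N * K) * (R - 1) ≤ ε * (R ^ 2 - 1) / (1 + (p + ε) * (R ^ 2 - 1)) *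
        (K * (1 - 1 / N - √(K * κ / N))) := by
  have hR0 : 0 < R := by linarith
  have hN0 : 0 < N := by linarith
  have hK0 : 0 < K := lt_of_lt_of_le (by positivity) hK
  have hX : 0 ≤ R ^ 2 - 1 := by nlinarith
  obtain ⟨p, hp⟩ : ∃ p, p = 1 / (4 * R ^ 2) := ⟨_, rfl⟩
  obtain ⟨ε, hε⟩ : ∃ ε, ε = √(N * K) / (8 * R * K) := ⟨_, rfl⟩
  have hp0 : 0 < p := by rw [hp]; positivity
  have hε0 : 0 < ε := by rw [hε]; positivity
  have hε2 : ε ^ 2 = N / (64 * R ^ 2 * K) := by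
    rw [hε, div_pow, Real.sq_sqrt (by positivity)]
    field_simp
    norm_num
  have hpR : p * R ^ 2 = 1 / 4 := by rw [hp]; field_simp
  have hp4 : p ≤ 1 / 4 := by nlinarith
  -- This is where `K` must be large: the inequality is equivalent to `N R² ≤ K`.
  have hεp : ε ≤ p / 2 := by
    refine abs_le_of_sq_le_sq' ?_ (by positivity) |>.2
    rw [hε2, hp, div_le_iff₀ (by positivity)]
    have : (1 / (4 * R ^ 2) / 2) ^ 2 * (64 * R ^ 2 * K) = K / R ^ 2 := by
      field_simp
      norm_num
    rw [this, le_div_iff₀ (by positivity)]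
    exact hK
  -- The factor `8/5` comes from `1 - (p + ε) ≥ 5/8`, as `p + ε ≤ 3/8`.
  have hκ : K * (8 / 5 * (ε ^ 2 / p)) / N = 1 / 10 := by
    rw [hε2, hp]
    field_simp
    norm_num
  refine ⟨p, ε, 8 / 5 * (ε ^ 2 / p), hp0, hε0.le, by linarith, ?_, by positivity, ?_⟩
  · refine (klSum_bern_le hp0 (by linarith) (by linarith) (by linarith)).trans ?_
    rw [add_sub_cancel_left]
    calc ε ^ 2 / ((p + ε) * (1 - (p + ε))) ≤ ε ^ 2 / (p * (5 / 8)) := by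
          refine div_le_div_of_nonneg_left (sq_nonneg ε) (by positivity) ?_
          exact mul_le_mul (by linarith) (by linarith) (by norm_num) (by linarith)
      _ = _ := by field_simp
  · rw [hκ]
    have h1 : 2 / 5 ≤ 1 - 1 / N - √(1 / 10) := by
      have h2 : √(1 / 10 : ℝ) ≤ 7 / 20 := by
        rw [Real.sqrt_le_left (by norm_num)]
        norm_num
      have h3 : 1 / N ≤ 1 / 4 := one_div_le_one_div_of_le (by norm_num) hN
      linarith
    -- Since `p R² = 1/4` and `ε ≤ p / 2`, the denominator is at most `1 + 3/8`.
    have h2 : ε * (R ^ 2 - 1) * (8 / 11) ≤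
        ε * (R ^ 2 - 1) / (1 + (p + ε) * (R ^ 2 - 1)) := by
      rw [div_eq_mul_inv (ε * (R ^ 2 - 1))]
      refine mul_le_mul_of_nonneg_left ?_ (by positivity)
      rw [show (8 / 11 : ℝ) = (11 / 8)⁻¹ by norm_num]
      refine inv_anti₀ (by positivity) ?_
      nlinarith
    -- `R² - 1 ≥ R (R - 1)`, and the factor `R` cancels the `1 / R` in `ε`.
    have h3 : √(N * K) / 8 * (R - 1) ≤ ε * K * (R ^ 2 - 1) := by
      have : ε * K = √(N * K) / 8 / R := by rw [hε]; field_simp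
      rw [this, div_mul_eq_mul_div _ R, le_div_iff₀ hR0, mul_assoc]
      refine mul_le_mul_of_nonneg_left ?_ (by positivity)
      nlinarith
    calc 2 / 55 * √(N * K) * (R - 1) = 8 / 11 * (2 / 5) * (√(N * K) / 8 * (R - 1)) := by ring
      _ ≤ 8 / 11 * (2 / 5) * (ε * K * (R ^ 2 - 1)) := by gcongr
      _ = ε * (R ^ 2 - 1) * (8 / 11) * (K * (2 / 5)) := by ring
      _ ≤ _ := by gcongr

theorem lowerBound_le_of_card {S A H K : ℕ} {β N R : ℝ} (hβ : 0 < β) (hH : 0 < H)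
    (hN : (S : ℝ) * A * H ≤ 18 * N) (hR : Real.exp (β * H / 6) ≤ R) :
    lowerBound S A H K β ≤ 1 / β * (2 / 55 * √(N * K) * (R - 1)) := by
  have hH' : (0 : ℝ) < H := Nat.cast_pos.2 hH
  have h6 : (0 : ℝ) < √6 := Real.sqrt_pos.2 (by norm_num)
  -- The factor 18 is relaxed to `24 = (2√6)²`, which cancels `√6` and leaves `1/36 ≤ 2/55`.
  have h1 : √((S : ℝ) * A * (K * H)) ≤ 2 * √6 * √(N * K) := by
    rw [show (2 * √6 : ℝ) = √24 by
      rw [show (24 : ℝ) = 2 ^ 2 * 6 by norm_num, Real.sqrt_mul (by norm_num),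
        Real.sqrt_sq (by norm_num)], ← Real.sqrt_mul (by norm_num)]
    refine Real.sqrt_le_sqrt ?_
    have hN0 : 0 ≤ N := by
      have : (0 : ℝ) ≤ (S : ℝ) * A * H := by positivity
      linarith
    have hK : (0 : ℝ) ≤ K := Nat.cast_nonneg K
    nlinarith [mul_le_mul_of_nonneg_right hN hK, mul_nonneg hN0 hK]
  have h2 : 0 ≤ Real.exp (β * H / 6) - 1 := sub_nonneg.2 (Real.one_le_exp (by positivity))
  have h3 : lowerBound S A H K β =
      1 / β * (1 / (72 * √6) * √((S : ℝ) * A * (K * H)) * (Real.exp (β * H / 6) - 1)) := by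
    unfold lowerBound
    field_simp
  rw [h3]
  refine mul_le_mul_of_nonneg_left ?_ (by positivity)
  refine mul_le_mul ?_ (by linarith) h2 (by positivity)
  calc 1 / (72 * √6) * √((S : ℝ) * A * (K * H)) ≤ 1 / (72 * √6) * (2 * √6 * √(N * K)) := by
        gcongr
    _ = 1 / 36 * √(N * K) := by field_simp; ring
    _ ≤ 2 / 55 * √(N * K) :=
        mul_le_mul_of_nonneg_right (by norm_num) (Real.sqrt_nonneg _)

end

end RiskMDP

/-! ### Fitting the instance to `S`, `A`, `H` and `d` -/

theorem mainTheorem3 {𝒮 𝒜 : Type*} [Fintype 𝒮] [DecidableEq 𝒮] [Fintype 𝒜] [DecidableEq 𝒜]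
    (S A H d : ℕ) (hS : S = Fintype.card 𝒮) (hA : A = Fintype.card 𝒜)
    (hS6 : 6 ≤ S) (hA2 : 2 ≤ A)
    (hSd : (S : ℝ) = 3 + ((A : ℝ) ^ d - 1) / ((A : ℝ) - 1)) (hHd : 3 * d ≤ H)
    (Hbar Lbar : ℝ) (hHbar : Hbar = (H : ℝ) / 3)
    (hLbar : Lbar = (1 - 1 / (A : ℝ)) * ((S : ℝ) - 3) + 1 / (A : ℝ)) :
    (∀ β : ℝ, 0 < β → ∀ K : ℕ,
      2 * Real.exp (β * ((H : ℝ) - Hbar - d)) * Hbar * Lbar * A ≤ (K : ℝ) →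
      ∀ alg : RiskMDP.Algorithm 𝒮 𝒜 H K,
        ∃ (M : RiskMDP.EpisodicMDP 𝒮 𝒜 H) (s₁ : 𝒮),
          RiskMDP.lowerBound S A H K β ≤ RiskMDP.expectedRegret β M alg (fun _ => s₁)) ∧
    (∀ K : ℕ, Filter.Tendsto (fun β : ℝ => RiskMDP.lowerBound S A H K β)
      (nhdsWithin 0 (Set.Ioi 0))
      (nhds (1 / (432 * Real.sqrt 6) * H * Real.sqrt (S * A * (K * H))))) := by
  have hA2' : (2 : ℝ) ≤ A := by exact_mod_cast hA2
  have hA0 : (0 : ℝ) < A := by linarith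
  have hA1 : (0 : ℝ) < (A : ℝ) - 1 := by linarith
  have hS6' : (6 : ℝ) ≤ S := by exact_mod_cast hS6
  -- `d = 0` and `d = 1` would give `S = 3` and `S = 4`. The words will have length `d - 1 = D + 1`.
  obtain ⟨D, rfl⟩ : ∃ D, d = D + 2 := by
    refine Nat.exists_eq_add_of_le' ?_
    by_contra hd
    have : d = 0 ∨ d = 1 := by omega
    rcases this with rfl | rfl
    · norm_num at hSd
      linarith
    · rw [pow_one, div_self hA1.ne'] at hSd
      linarith
  have hH6 : 6 ≤ H := by omega
  have hH6' : (6 : ℝ) ≤ H := by exact_mod_cast hH6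
  have hHd' : 3 * ((D : ℝ) + 2) ≤ H := by exact_mod_cast hHd
  refine ⟨fun β hβ K hK alg => ?_, fun K => RiskMDP.tendsto_lowerBound S A H K (by omega)⟩
  obtain ⟨L, hL⟩ : ∃ L : ℝ, L = (A : ℝ) ^ (D + 1) := ⟨_, rfl⟩
  have hSL : ((S : ℝ) - 3) * (A - 1) = A * L - 1 := by
    rw [hSd, add_sub_cancel_left, div_mul_cancel₀ _ hA1.ne', hL]
    ring
  have hLbar' : Lbar = L := by
    rw [hLbar]
    field_simp
    linarith
  have hL2 : 2 ≤ L := by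
    rw [hL]
    exact hA2'.trans (le_self_pow₀ (by linarith) (Nat.succ_ne_zero D))
  -- There is room for the `L` words and the two absorbing states; the remaining states are
  -- unreachable.
  have hSL2 : L + 2 ≤ S := by
    have : (L - 1) * (A - 1) ≤ ((S : ℝ) - 3) * (A - 1) := by rw [hSL]; nlinarith
    linarith [le_of_mul_le_mul_right this hA1]
  have hSL3 : (S : ℝ) ≤ 3 * L := by
    have : ((S : ℝ) - 3) * (A - 1) ≤ (3 * L - 3) * (A - 1) := by
      rw [hSL]
      nlinarith [mul_nonneg (show 0 ≤ 2 * L - 3 by linarith) (sub_nonneg.2 hA2')]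
    linarith [le_of_mul_le_mul_right this hA1]
  -- the embedding of the cells and the waiting time
  have hcard : Fintype.card (RiskMDP.Cell 𝒜 (D + 1)) ≤ Fintype.card 𝒮 := by
    rw [← hS]
    simp only [Fintype.card_sum, Fintype.card_fun, Fintype.card_fin, Fintype.card_bool, ← hA]
    rw [hL] at hSL2
    exact_mod_cast hSL2
  obtain ⟨e⟩ := Function.Embedding.nonempty_of_card_le hcard
  obtain ⟨w⟩ : Nonempty 𝒜 := Fintype.card_pos_iff.1 (by omega)
  have : Nonempty (RiskMDP.Cell 𝒜 (D + 1)) := ⟨.inr true⟩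
  -- `W` is `H / 3` rounded up.
  obtain ⟨W, hW⟩ : ∃ W, W = (H + 2) / 3 := ⟨_, rfl⟩
  have hW1 : (H : ℝ) ≤ 3 * W := by
    have : H ≤ 3 * W := by omega
    exact_mod_cast this
  have hW2 : 3 * (W : ℝ) ≤ H + 2 := by
    have : 3 * W ≤ H + 2 := by omega
    exact_mod_cast this
  have hDW : D + 1 + W < H := by omega
  -- the total reward in the good state
  obtain ⟨G, hG⟩ : ∃ G : ℝ, G = 2 * H / 3 - (D + 2) := ⟨_, rfl⟩
  have hn : ((H - (D + 1 + W) : ℕ) : ℝ) = H - (D + 1 + W) := by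
    rw [Nat.cast_sub hDW.le]
    push_cast
    ring
  have hn0 : (0 : ℝ) < ((H - (D + 1 + W) : ℕ) : ℝ) := Nat.cast_pos.2 (by omega)
  have hr : G / ((H - (D + 1 + W) : ℕ) : ℝ) ∈ Set.Icc (0 : ℝ) 1 := by
    refine ⟨div_nonneg (by linarith) hn0.le, (div_le_one hn0).2 ?_⟩
    rw [hn]
    linarith
  obtain ⟨R, hR⟩ : ∃ R, R = Real.exp (β * G / 2) := ⟨_, rfl⟩
  have hR2 : R ^ 2 = Real.exp (β * G) := by
    rw [hR, ← Real.exp_nat_mul]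
    congr 1
    push_cast
    ring
  -- `d ≤ H / 3` gives `G ≥ H / 3`.
  have hHR : Real.exp (β * H / 6) ≤ R := by
    rw [hR, Real.exp_le_exp]
    have : β * H ≤ β * (3 * G) := mul_le_mul_of_nonneg_left (by linarith) hβ.le
    linarith
  have hR1 : 1 ≤ R := by
    refine le_trans (Real.one_le_exp ?_) hHR
    positivity
  -- the number of arms
  have hcardN : ((RiskMDP.starArms (D + 1) W w).card : ℝ) = W * (L * (A - 1)) := by
    rw [RiskMDP.card_starArms, ← hA, hL]
    push_cast [Nat.cast_sub (show 1 ≤ A by omega)]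
    ring
  obtain ⟨N, hN⟩ : ∃ N : ℝ, N = ((RiskMDP.starArms (D + 1) W w).card : ℝ) := ⟨_, rfl⟩
  rw [← hN] at hcardN
  have hN4 : 4 ≤ N := by
    have h1 : 2 * 1 ≤ L * (A - 1) := mul_le_mul hL2 (by linarith) zero_le_one (by linarith)
    have h2 : (2 : ℝ) ≤ W := by linarith
    rw [hcardN]
    calc (4 : ℝ) = 2 * (2 * 1) := by norm_num
      _ ≤ W * (L * (A - 1)) := mul_le_mul h2 h1 (by norm_num) (Nat.cast_nonneg W)
  have hN18 : (S : ℝ) * A * H ≤ 18 * N := by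
    have h1 : (S : ℝ) * A ≤ (3 * L) * (2 * (A - 1)) :=
      mul_le_mul hSL3 (by linarith) hA0.le (by linarith)
    have h2 : (S : ℝ) * A * H ≤ (3 * L) * (2 * (A - 1)) * (3 * W) :=
      mul_le_mul h1 hW1 (by linarith)
        (mul_nonneg (by linarith) (mul_nonneg zero_le_two hA1.le))
    rw [hcardN]
    linarith
  have hNK : N * R ^ 2 ≤ K := by
    have hG' : (H : ℝ) - Hbar - ((D + 2 : ℕ) : ℝ) = G := by
      rw [hHbar, hG]
      push_cast
      ring
    rw [hG', ← hR2, hLbar', hHbar] at hK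
    refine le_trans ?_ hK
    -- The factor 2 in the condition on `K` absorbs the rounding: `3 W ≤ H + 2 ≤ 2 H`.
    have h1 : (W : ℝ) * (L * (A - 1)) ≤ 2 * (H / 3) * (L * A) :=
      mul_le_mul (by linarith) (mul_le_mul_of_nonneg_left (by linarith) (by linarith))
        (mul_nonneg (by linarith) hA1.le) (by linarith)
    calc N * R ^ 2 ≤ 2 * (H / 3) * (L * A) * R ^ 2 := by rw [hcardN]; gcongr
      _ = _ := by ring
  obtain ⟨p, ε, κ, hp, hε, hpε, hκ, hκ0, hgap⟩ := RiskMDP.exists_gap hN4 hR1 hNK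
  have hNe : (RiskMDP.starArms (D + 1) W w).Nonempty := by
    rw [← Finset.card_pos]
    have : (0 : ℝ) < ((RiskMDP.starArms (D + 1) W w).card : ℝ) := by linarith
    exact_mod_cast this
  obtain ⟨M, hM⟩ := RiskMDP.exists_le_expectedRegret (W := W) (w := w) (X := R ^ 2 - 1) e.injective
    (Function.leftInverse_invFun e.injective) hDW (by omega) alg (fun _ => w) ⟨_, hr⟩ hp hε hpε hβ
    hκ hκ0 hNe
    (by rw [hR2, mul_div_cancel₀ _ hn0.ne'])
  refine ⟨M, _, le_trans ?_ hM⟩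
  rw [← hN, mul_assoc]
  exact (RiskMDP.lowerBound_le_of_card hβ (by omega) hN18 hHR).trans
    (mul_le_mul_of_nonneg_left hgap (by positivity))
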